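/- Let $I$ (the set of players) and $S$ (the set of states of nature) be sets with $|I|\ge 2$ and $|S|\ge 2$. An *$\infty$-field* on a nonempty set $M$ is a field $\Sigma$ of subsets of $M$ such that $\bigcap\mathcal E\in\Sigma$ for every $\mathcal E\subseteq\Sigma$, of whatever cardinality. For a field $\Sigma$ on $M$, let $\Delta(M,\Sigma)$ be the set of finitely additive probability measures on $(M,\Sigma)$, i.e. of all $\mu:\Sigma\to[0,1]$ with $\mu(M)=1$ and $\mu(E\cup F)=\mu(E)+\mu(F)$ for all disjoint $E,F\in\Sigma$. An *$\infty$-type space on $S$ for player set $I$* is a tuple $\langle M,\Sigma,(T_i)_{i\in I},\theta\rangle$ where $M$ is a nonempty set; $\Sigma$ is an $\infty$-field on $M$; $\theta:M\to S$ satisfies $\theta^{-1}(A)\in\Sigma$ for every $A\subseteq S$; and, for each $i\in I$, $T_i:M\to\Delta(M,\Sigma)$ is measurable with respect to $\Sigma$ and the $\infty$-field on $\Delta(M,\Sigma)$ generated by the sets $\{\mu:\mu(E)\ge p\}$ ($E\in\Sigma$, $p\in[0,1]$), and has the introspection property: for all $m\in M$ and $A\in\Sigma$, if $[T_i(m)]:=\{m'\in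 M: T_i(m')=T_i(m)\}\subseteq A$ then $T_i(m)(A)=1$. A *$*$-type space on $S$ for player set $I$* is a tuple $\langle M,(T_i)_{i\in I},\theta\rangle$ where $M$ is a nonempty set, $\theta:M\to S$ is any function, and, for each $i\in I$, $T_i:M\to\Delta(M,\mathrm{Pow}(M))$ is a function with $T_i(m)([T_i(m)])=1$ for all $m\in M$; here one puts $\Sigma:=\mathrm{Pow}(M)$. A *type morphism* from $\langle M',\Sigma',(T'_i)_{i\in I},\theta'\rangle$ to $\langle M,\Sigma,(T_i)_{i\in I},\theta\rangle$ is a function $f:M'\to M$ such that $f^{-1}(E)\in\Sigma'$ for all $E\in\Sigma$, $\theta'(m')=\theta(f(m'))$ for all $m'\in M'$, and $T_i(f(m'))(E)=T'_i(m')(f^{-1}(E))$ for all $m'\in M'$, $E\in\Sigma$, $i\in I$. An $\infty$-type space (respectively $*$-type space) $\underline\Omega$ on $S$ for player set $I$ is *universal* if for every $\infty$-type space (respectively $*$-type space) $\underline M$ on $S$ for player set $I$ there is a unique type morphism from $\underline M$ to $\underline\Omega$. Then there is no universal $\infty$-type space on $S$ for player set $I$, and there is no universal $*$-type space on $S$ for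 player set $I$. -/

import Mathlib

universe u v w

namespace HarsanyiTypes

/-- A field of subsets of `M`. -/
structure SetField (M : Type w) where
  sets : Set (Set M)
  isSetAlgebra : MeasureTheory.IsSetAlgebra sets

/-- The power set of `M`, as a field on `M`. -/
def SetField.pow (M : Type w) : SetField M where
  sets := Set.univ
  isSetAlgebra := ⟨trivial, fun _ _ => trivial, fun _ _ _ _ => trivial⟩

/-- An `∞`-field: a field closed under the intersection of every subfamily, whatever its
cardinality. -/
structure InfField (M : Type w) extends SetField M where
  sInter_mem : ∀ 𝓔 : Set (Set M), 𝓔 ⊆ sets → ⋂₀ 𝓔 ∈ sets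

/-- The `∞`-field generated by a family `𝓖`: the members common to all `∞`-fields
containing `𝓖`. -/
def InfField.generateFrom {X : Type w} (𝓖 : Set (Set X)) : InfField X where
  sets := {B | ∀ 𝓗 : InfField X, 𝓖 ⊆ 𝓗.sets → B ∈ 𝓗.sets}
  isSetAlgebra :=
    { empty_mem := fun 𝓗 _ => 𝓗.isSetAlgebra.empty_mem
      compl_mem := fun _ hs 𝓗 h => 𝓗.isSetAlgebra.compl_mem (hs 𝓗 h)
      union_mem := fun _ _ hs ht 𝓗 h => 𝓗.isSetAlgebra.union_mem (hs 𝓗 h) (ht 𝓗 h) }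
  sInter_mem := fun 𝓔 hE 𝓗 h => 𝓗.sInter_mem 𝓔 fun _ hA => hE hA 𝓗 h

/-- A finitely additive probability measure on `(M, 𝓕)`. It is a function on the members of
`𝓕` only, so that two measures are equal iff they agree on `𝓕`. Since all values are at most
`μ M = 1`, real values lose nothing. -/
@[ext]
structure FinAddProb {M : Type w} (𝓕 : SetField M) where
  toFun : 𝓕.sets → ℝ
  nonneg : ∀ E, 0 ≤ toFun E
  add : ∀ E F : 𝓕.sets, Disjoint (E : Set M) (F : Set M) →
    toFun ⟨(E : Set M) ∪ (F : Set M), 𝓕.isSetAlgebra.union_mem E.2 F.2⟩ = toFun E + toFun F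
  univ : toFun ⟨Set.univ, 𝓕.isSetAlgebra.univ_mem⟩ = 1

/-- The `∞`-field on the space of finitely additive probability measures on `(M, 𝓕)` generated
by the sets `{μ | p ≤ μ E}` with `E ∈ 𝓕` and `p ∈ [0, 1]`. -/
def FinAddProb.infField {M : Type w} (𝓕 : SetField M) : InfField (FinAddProb 𝓕) :=
  InfField.generateFrom
    {B | ∃ (E : 𝓕.sets) (p : ℝ), p ∈ Set.Icc (0 : ℝ) 1 ∧
      B = {μ : FinAddProb 𝓕 | p ≤ μ.toFun E}}

/-- The data `⟨M, Σ, (T_i), θ⟩` common to all kinds of type spaces: a nonempty set with a field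
of events, a finitely additive probability measure for each player and state, and a map to the
states of nature. No measurability or introspection is required yet. -/
structure TypeStructure (I : Type u) (S : Type v) where
  carrier : Type w
  nonempty : Nonempty carrier
  events : SetField carrier
  T : I → carrier → FinAddProb events
  θ : carrier → S

/-- `[T_i(m)]`, the set of states in which player `i` has the same type as in `m`. -/
def TypeStructure.typeClass {I : Type u} {S : Type v} (M : TypeStructure.{u, v, w} I S)
    (i : I) (m : M.carrier) : Set M.carrier :=
  {m' | M.T i m' = M.T i m}

/-- Type morphisms `f : M' → M`. -/
structure IsTypeMorphism {I : Type u} {S : Type v} (M' M : TypeStructure.{u, v, w} I S)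
    (f : M'.carrier → M.carrier) : Prop where
  measurable : ∀ E ∈ M.events.sets, f ⁻¹' E ∈ M'.events.sets
  nature : ∀ m', M'.θ m' = M.θ (f m')
  beliefs : ∀ (m' : M'.carrier) (E : M.events.sets) (i : I),
    (M.T i (f m')).toFun E = (M'.T i m').toFun ⟨f ⁻¹' (E : Set M.carrier), measurable E E.2⟩

/-- An `∞`-type space on `S` for player set `I`. -/
structure InfTypeSpace (I : Type u) (S : Type v) extends TypeStructure.{u, v, w} I S where
  sInter_mem : ∀ 𝓔 : Set (Set carrier), 𝓔 ⊆ events.sets → ⋂₀ 𝓔 ∈ events.sets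
  measurable_T : ∀ i : I, ∀ B ∈ (FinAddProb.infField events).sets, T i ⁻¹' B ∈ events.sets
  introspection : ∀ (i : I) (m : carrier) (A : events.sets),
    toTypeStructure.typeClass i m ⊆ (A : Set carrier) → (T i m).toFun A = 1
  measurable_θ : ∀ A : Set S, θ ⁻¹' A ∈ events.sets

/-- A `*`-type space on `S` for player set `I`: all subsets are events. -/
structure StarTypeSpace (I : Type u) (S : Type v) where
  carrier : Type w
  nonempty : Nonempty carrier
  T : I → carrier → FinAddProb (SetField.pow carrier)
  θ : carrier → S
  introspection : ∀ (i : I) (m : carrier), (T i m).toFun ⟨{m' | T i m' = T i m}, trivial⟩ = 1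

/-- A `*`-type space viewed as a 4-tuple, with the power set as field of events. -/
def StarTypeSpace.toTypeStructure {I : Type u} {S : Type v} (M : StarTypeSpace.{u, v, w} I S) :
    TypeStructure.{u, v, w} I S where
  carrier := M.carrier
  nonempty := M.nonempty
  events := SetField.pow M.carrier
  T := M.T
  θ := M.θ

/-- An `∞`-type space is universal if every `∞`-type space has a unique type morphism to it. -/
def InfTypeSpace.IsUniversal {I : Type u} {S : Type v} (Ω : InfTypeSpace.{u, v, w} I S) : Prop :=
  ∀ M : InfTypeSpace.{u, v, w} I S, ∃! f : M.carrier → Ω.carrier,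
    IsTypeMorphism M.toTypeStructure Ω.toTypeStructure f

/-- A `*`-type space is universal if every `*`-type space has a unique type morphism to it. -/
def StarTypeSpace.IsUniversal {I : Type u} {S : Type v} (Ω : StarTypeSpace.{u, v, w} I S) : Prop :=
  ∀ M : StarTypeSpace.{u, v, w} I S, ∃! f : M.carrier → Ω.carrier,
    IsTypeMorphism M.toTypeStructure Ω.toTypeStructure f

end HarsanyiTypes

namespace HarsanyiTypes

/-! The events of a type space can encode arbitrarily long transfinite hierarchies of beliefs, so no
fixed space receives morphisms from all others. For a well-order `W`, `ordinalSpace` carries one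
such hierarchy: nature marks the minimum, and for other `b` player `i` at `(b, b)` is certain that
the second coordinate lies below `b` yet above each smaller bound. At limits this belief is only
finitely additive. Certainty events and unions then define each initial segment of the diagonal, so
a morphism into `Ω` is injective there (`ordinalSpace_diagonal_injective`). Taking `W` larger than
`Ω` gives a contradiction. -/

open Classical in
/-- The two-valued finitely additive probability measure given by an ultrafilter. -/
noncomputable def FinAddProb.ofUltrafilter {M : Type w} (𝓕 : SetField M) (U : Ultrafilter M) :
    FinAddProb 𝓕 where
  toFun E := if (E : Set M) ∈ U then 1 else 0
  nonneg E := by split_ifs <;> norm_num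
  add E F h := by
    have hEF : (E : Set M) ∈ U → (F : Set M) ∉ U := fun hE hF =>
      U.empty_notMem (by simpa [h.inter_eq] using Filter.inter_mem hE hF)
    by_cases hE : (E : Set M) ∈ U
    · simp [Ultrafilter.union_mem_iff, hE, hEF hE]
    · simp [Ultrafilter.union_mem_iff, hE]
  univ := if_pos Filter.univ_mem

theorem FinAddProb.ofUltrafilter_eq_one {M : Type w} {𝓕 : SetField M} {U : Ultrafilter M}
    {E : 𝓕.sets} (h : (E : Set M) ∈ U) : (ofUltrafilter 𝓕 U).toFun E = 1 :=
  if_pos h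

theorem FinAddProb.one_le_ofUltrafilter {M : Type w} {𝓕 : SetField M} {U : Ultrafilter M}
    {E : 𝓕.sets} : 1 ≤ (ofUltrafilter 𝓕 U).toFun E ↔ (E : Set M) ∈ U := by
  by_cases h : (E : Set M) ∈ U <;> simp [ofUltrafilter, h]

/-- Extend the filter of tails of `Set.Iio b`; it is proper when `b` is not minimal. -/
theorem exists_ultrafilter_Ico_mem {W : Type w} [LinearOrder W] (b : W) :
    ∃ U : Ultrafilter W, ∀ a < b, Set.Ico a b ∈ U := by
  by_cases hb : Nonempty (Set.Iio b)
  · refine ⟨Ultrafilter.of (Filter.map ((↑) : Set.Iio b → W) Filter.atTop), fun a ha => ?_⟩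
    refine Ultrafilter.of_le _ (Filter.mem_map.2 ?_)
    filter_upwards [Filter.Ici_mem_atTop (⟨a, ha⟩ : Set.Iio b)] with c hc
    exact ⟨hc, c.2⟩
  · exact ⟨pure b, fun a ha => (hb ⟨⟨a, ha⟩⟩).elim⟩

/-- An ultrafilter that, for `b` not minimal, contains `Set.Ico a b` for every `a < b`. -/
noncomputable def ultrafilterBelow {W : Type w} [LinearOrder W] (b : W) : Ultrafilter W :=
  (exists_ultrafilter_Ico_mem b).choose

theorem Ico_mem_ultrafilterBelow {W : Type w} [LinearOrder W] {a b : W} (h : a < b) :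
    Set.Ico a b ∈ ultrafilterBelow b :=
  (exists_ultrafilter_Ico_mem b).choose_spec a h

/-- This is how `i`'s certainty reads off `b`: if `a < b`, the large set `Set.Ico a b` misses
`Set.Iio a`. -/
theorem Iio_mem_ultrafilterBelow {W : Type w} [LinearOrder W] {a b : W} (hb : ¬ IsMin b) :
    Set.Iio a ∈ ultrafilterBelow b ↔ b ≤ a := by
  refine ⟨fun h => not_lt.1 fun hab => ?_, fun h => ?_⟩
  · obtain ⟨x, hx, hx'⟩ :=
      (ultrafilterBelow b).nonempty_of_mem (Filter.inter_mem h (Ico_mem_ultrafilterBelow hab))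
    exact absurd hx'.1 (not_le.2 hx)
  · obtain ⟨c, hc⟩ := not_isMin_iff.1 hb
    exact Filter.mem_of_superset (Ico_mem_ultrafilterBelow hc) fun x hx => hx.2.trans_le h

open Classical in
/-- The `*`-type space on `W × W` in which player `i` at `(b, a)` is certain of `b` and believes
that the second coordinate is below `b` but above every `a' < b`, while everybody else is certain
of `(a, a)`. -/
noncomputable def ordinalSpace {I : Type u} {S : Type v} (W : Type w) [LinearOrder W]
    [Nonempty W] (i : I) (s t : S) : StarTypeSpace.{u, v, w} I S where
  carrier := W × W
  nonempty := inferInstance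
  T k m := FinAddProb.ofUltrafilter _
    (if k = i then (ultrafilterBelow m.1).map (Prod.mk m.1) else pure (m.2, m.2))
  θ m := if IsMin m.1 then s else t
  introspection k m := by
    apply FinAddProb.ofUltrafilter_eq_one
    by_cases h : k = i
    · rw [if_pos h, Ultrafilter.mem_map]
      -- The type of `i` depends only on the first coordinate, so the whole fibre over `m.1` lies in
      -- its class.
      exact Filter.mem_of_superset Filter.univ_mem fun c _ => by simp [h]
    · simp [h]

/-- A `*`-type space is an `∞`-type space. -/
def StarTypeSpace.toInfTypeSpace {I : Type u} {S : Type v} (M : StarTypeSpace.{u, v, w} I S) :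
    InfTypeSpace.{u, v, w} I S where
  toTypeStructure := M.toTypeStructure
  sInter_mem _ _ := trivial
  measurable_T _ _ _ := trivial
  measurable_θ _ := trivial
  introspection i m := by
    rintro ⟨A, _⟩ hA
    let μ := M.T i m
    let C : Set M.carrier := {m' | M.T i m' = μ}
    change C ⊆ A at hA
    change μ.toFun ⟨A, trivial⟩ = 1
    have hC : μ.toFun ⟨C, trivial⟩ = 1 := M.introspection i m
    -- Monotonicity: `μ C = 1` and `C ⊆ A` force `μ A = 1`.
    have hadd := μ.add ⟨C, trivial⟩ ⟨A \ C, trivial⟩ Set.disjoint_sdiff_right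
    have hadd' := μ.add ⟨A, trivial⟩ ⟨Aᶜ, trivial⟩ disjoint_compl_right
    rw [hC] at hadd
    simp only [Set.union_sdiff_cancel hA] at hadd
    have huniv : μ.toFun ⟨A ∪ Aᶜ, trivial⟩ = 1 := by
      rw [← μ.univ]
      congr 2
      exact Set.union_compl_self A
    have h₁ := μ.nonneg ⟨A \ C, trivial⟩
    have h₂ := μ.nonneg ⟨Aᶜ, trivial⟩
    linarith only [hadd, hadd', huniv, h₁, h₂]

-- The three closure hypotheses on `Ω` hold in both kinds of type space, so one argument serves
-- both.
open Classical in
theorem ordinalSpace_diagonal_injective {I : Type u} {S : Type v} {W : Type w} [LinearOrder W]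
    [WellFoundedLT W] [Nonempty W] {i j : I} (hij : j ≠ i) {s t : S} (hst : t ≠ s)
    {Ω : TypeStructure.{u, v, w} I S}
    (hInter : ∀ 𝓔 : Set (Set Ω.carrier), 𝓔 ⊆ Ω.events.sets → ⋂₀ 𝓔 ∈ Ω.events.sets)
    (hT : ∀ (k : I) (E : Ω.events.sets), {ω | 1 ≤ (Ω.T k ω).toFun E} ∈ Ω.events.sets)
    (hθ : ∀ A : Set S, Ω.θ ⁻¹' A ∈ Ω.events.sets)
    {f : W × W → Ω.carrier}
    (hf : IsTypeMorphism (ordinalSpace W i s t).toTypeStructure Ω f) :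
    Function.Injective fun a => f (a, a) := by
  have hbel (k : I) (m : W × W) (E : Ω.events.sets) : 1 ≤ (Ω.T k (f m)).toFun E ↔
      f ⁻¹' (E : Set Ω.carrier) ∈
        (if k = i then (ultrafilterBelow m.1).map (Prod.mk m.1) else pure (m.2, m.2) :
          Ultrafilter (W × W)) := by
    rw [hf.beliefs m E k]
    exact FinAddProb.one_le_ofUltrafilter
  have hnat (b : W) : Ω.θ (f (b, b)) = s ↔ IsMin b := by
    have h := hf.nature (b, b)
    rw [← h]
    change (if IsMin b then s else t) = s ↔ _
    split_ifs with h <;> simp [h, hst]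
  have hUnion (𝓔 : Set (Set Ω.carrier)) (h : 𝓔 ⊆ Ω.events.sets) : ⋃₀ 𝓔 ∈ Ω.events.sets := by
    rw [Set.sUnion_eq_compl_sInter_compl]
    refine Ω.events.isSetAlgebra.compl_mem (hInter _ ?_)
    rintro _ ⟨E, hE, rfl⟩
    exact Ω.events.isSetAlgebra.compl_mem (h hE)
  have key (a : W) : ∃ B ∈ Ω.events.sets, ∀ b, f (b, b) ∈ B ↔ b ≤ a := by
    induction a using WellFoundedLT.induction with
    | ind a ih =>
      choose B hB hBmem using ih
      -- Closure under arbitrary unions carries the induction through limit stages.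
      let V : Ω.events.sets := ⟨⋃₀ {X | ∃ c hc, X = B c hc}, hUnion _ (by
        rintro _ ⟨c, hc, rfl⟩
        exact hB c hc)⟩
      have hV (b : W) : f (b, b) ∈ (V : Set Ω.carrier) ↔ b < a := by
        constructor
        · rintro ⟨_, ⟨c, hc, rfl⟩, hb⟩
          exact ((hBmem c hc b).1 hb).trans_lt hc
        · exact fun hb => ⟨_, ⟨b, hb, rfl⟩, (hBmem b hb b).2 le_rfl⟩
      -- Certainty of `j` turns a condition on the diagonal into one on the second coordinate, about
      -- which `i` has beliefs.
      let E : Ω.events.sets := ⟨_, hT j V⟩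
      have hE (m : W × W) : f m ∈ (E : Set Ω.carrier) ↔ m.2 < a := by
        refine (hbel j m V).trans ?_
        rw [if_neg hij, ← hV]
        rfl
      -- The nature event covers minimal `b`, where `ultrafilterBelow` is unconstrained.
      refine ⟨Ω.θ ⁻¹' {s} ∪ {ω | 1 ≤ (Ω.T i ω).toFun E},
        Ω.events.isSetAlgebra.union_mem (hθ _) (hT i E), fun b => ?_⟩
      have hF : f (b, b) ∈ {ω | 1 ≤ (Ω.T i ω).toFun E} ↔ Set.Iio a ∈ ultrafilterBelow b := by
        refine (hbel i (b, b) E).trans ?_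
        rw [if_pos rfl, Ultrafilter.mem_map]
        have : Prod.mk b ⁻¹' (f ⁻¹' (E : Set Ω.carrier)) = Set.Iio a := Set.ext fun c => hE (b, c)
        rw [← this]
      rw [Set.mem_union, hF, Set.mem_preimage, Set.mem_singleton_iff, hnat]
      by_cases hb : IsMin b
      · simp only [hb, true_or, true_iff]
        exact (le_total b a).elim id fun h => hb h
      · simp only [hb, false_or, Iio_mem_ultrafilterBelow hb]
  intro a b hab
  obtain ⟨A, -, hA⟩ := key a
  obtain ⟨B, -, hB⟩ := key b
  simp only at hab
  exact le_antisymm ((hB a).1 (hab ▸ (hB b).2 le_rfl)) ((hA b).1 (hab ▸ (hA a).2 le_rfl))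

/-- Well-order the power set of `X` and apply Cantor's theorem. -/
theorem exists_wellOrder_not_injective (X : Type w) :
    ∃ (W : Type w) (_ : LinearOrder W) (_ : WellFoundedLT W) (_ : Nonempty W),
      ∀ g : W → X, ¬ Function.Injective g := by
  obtain ⟨_, hwf⟩ := exists_wellFoundedLT (ULift.{w} (Set X))
  exact ⟨ULift.{w} (Set X), _, hwf, inferInstance, fun g hg =>
    Function.cantor_injective (fun A => g ⟨A⟩) fun _ _ h => ULift.up_injective (hg h)⟩

end HarsanyiTypes

open HarsanyiTypes in
theorem corollary1 {I : Type u} {S : Type v}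
    (hI : 2 ≤ Cardinal.mk I) (hS : 2 ≤ Cardinal.mk S) :
    (¬ ∃ Ω : HarsanyiTypes.InfTypeSpace.{u, v, w} I S, Ω.IsUniversal) ∧
    (¬ ∃ Ω : HarsanyiTypes.StarTypeSpace.{u, v, w} I S, Ω.IsUniversal) := by
  obtain ⟨j, i, hij⟩ := Cardinal.two_le_iff.1 hI
  obtain ⟨t, s, hst⟩ := Cardinal.two_le_iff.1 hS
  constructor
  · rintro ⟨Ω, hΩ⟩
    obtain ⟨W, _, _, _, hW⟩ := exists_wellOrder_not_injective Ω.carrier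
    obtain ⟨f, hf, -⟩ := hΩ (ordinalSpace W i s t).toInfTypeSpace
    exact hW _ (ordinalSpace_diagonal_injective hij hst Ω.sInter_mem
      -- Certainty of `E` is the preimage of a generator with `p = 1`.
      (fun k E => Ω.measurable_T k _ fun _ h => h ⟨E, 1, by simp, rfl⟩) Ω.measurable_θ hf)
  · rintro ⟨Ω, hΩ⟩
    obtain ⟨W, _, _, _, hW⟩ := exists_wellOrder_not_injective Ω.carrier
    obtain ⟨f, hf, -⟩ := hΩ (ordinalSpace W i s t)
    exact hW _ (ordinalSpace_diagonal_injective hij hst (Ω := Ω.toTypeStructure)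
      (fun _ _ => trivial)
      (fun _ _ => trivial) (fun _ => trivial) hf)
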